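/- Let $n\ge 2$, let $D\subseteq\mathbb R^n$ be bounded and open, let $x_0\in D$, and assume $|\partial D|:=H^{n-1}(\partial D)<\infty$; write $\sigma=H^{n-1}$ for the $(n-1)$-dimensional Hausdorff measure. *Definitions.* A Dini function is a continuous increasing $\omega:(0,\infty)\to(0,\infty)$ such that $s\mapsto\omega(s)/s$ is monotone and $\int_0^R\frac{\omega(s)}{s}\,ds<\infty$ for every $R>0$. A map $f$ on a set $A\subseteq\mathbb R^n$ is Dini-continuous at $z\in A$ if there are a Dini function $\omega$ and $\delta>0$ with $|f(x)-f(z)|\le\omega(|x-z|)$ for all $x\in A$ with $0<|x-z|<\delta$. An open set $D$ is Lyapunov-Dini at $z\in\partial D$ if there is an open neighbourhood $V$ of $z$ such that $\partial D\cap V$ is a $C^1$ hypersurface which has an outward unit normal $\nu(x)$ to $D$ at each of its points $x$ (a unit vector orthogonal to the tangent space of $\partial D$ at $x$, with $x+t\nu(x)\notin\overline D$ and $x-t\nu(x)\in D$ for all small $t>0$), and $\nu:\partial D\cap V\to\mathbb R^n$ is Dini-continuous at $z$. Let $B=B(x_0,\operatorname{dist}(x_0,\partial D))$ be the biggest ball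 centred at $x_0$ and contained in $D$. The regular touching set is $$T(\partial D,x_0)=\{z\in\partial D\cap\partial B:\ D\text{ is Lyapunov-Dini at }z\}.$$ For $\alpha\in\mathbb R^n$ and $x\neq\alpha$ put $$h_\alpha(x)=|\alpha|^{n-2}\,\frac{|x|^2-|\alpha|^2}{|x-\alpha|^n},\qquad k_\alpha=1+h_\alpha .$$ If $0\in D$ and $z\in T(\partial D,0)$, let $$L(z)=\liminf_{\alpha\searrow z,\ \alpha\notin\overline D}\left|k_\alpha(0)-\frac1{|\partial D|}\int_{\partial D}k_\alpha\,d\sigma\right|,\qquad L^*(z)=\limsup_{\alpha\searrow z,\ \alpha\notin\overline D}\frac1{|\partial D|}\int_{\partial D}|h_\alpha|\,d\sigma,$$ where $\alpha\searrow z$, $\alpha\notin\overline D$, means $\alpha=tz$ with $t>1$, $tz\notin\overline D$, $t\to1$. The Kuran gap $\mathcal K$ and the quantity $h^*$, both with values in $[0,\infty]$, are $$\mathcal K(\partial D,0)=\inf_{z\in T(\partial D,0)}L(z),\qquad h^*(\partial D,0)=\inf_{z\in T(\partial D,0)}L^*(z),$$ with $\inf\emptyset=+\infty$, and for general $x_0\in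 D$ one sets $\mathcal K(\partial D,x_0)=\mathcal K(\partial(-x_0+D),0)$ and $h^*(\partial D,x_0)=h^*(\partial(-x_0+D),0)$. *Statement.* 1. If $T(\partial D,x_0)\neq\emptyset$, then $h^*(\partial D,x_0)<\infty$. 2. $\mathcal K(\partial D,x_0)<\infty$ if and only if $T(\partial D,x_0)\neq\emptyset$. -/

import Mathlib

open MeasureTheory Filter Topology
open scoped ENNReal

namespace KuranGap

noncomputable section

/-- A Dini function: a continuous increasing `ω : (0, ∞) → (0, ∞)` such that `s ↦ ω s / s` is
monotone (in either direction) and integrable on `(0, R)` for every `R > 0`. -/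
structure IsDiniFunction (ω : ℝ → ℝ) : Prop where
  pos : ∀ s, 0 < s → 0 < ω s
  continuousOn : ContinuousOn ω (Set.Ioi 0)
  monotoneOn : MonotoneOn ω (Set.Ioi 0)
  quotient_monotone :
    MonotoneOn (fun s => ω s / s) (Set.Ioi 0) ∨ AntitoneOn (fun s => ω s / s) (Set.Ioi 0)
  integrableOn : ∀ R, 0 < R → IntegrableOn (fun s => ω s / s) (Set.Ioo 0 R)

/-- The map `f`, considered on the set `A`, is Dini-continuous at the point `z`. -/
def DiniContinuousAt {n : ℕ} (f : EuclideanSpace ℝ (Fin n) → EuclideanSpace ℝ (Fin n))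
    (A : Set (EuclideanSpace ℝ (Fin n))) (z : EuclideanSpace ℝ (Fin n)) : Prop :=
  ∃ ω : ℝ → ℝ, IsDiniFunction ω ∧ ∃ δ : ℝ, 0 < δ ∧
    ∀ x ∈ A, 0 < ‖x - z‖ → ‖x - z‖ < δ → ‖f x - f z‖ ≤ ω ‖x - z‖

/-- `S` is an embedded `C¹` hypersurface of `ℝⁿ` (a `C¹` submanifold of dimension `n - 1`):
near each of its points it is the zero set of a `C¹` function with nonvanishing differential. -/
def IsC1Hypersurface {n : ℕ} (S : Set (EuclideanSpace ℝ (Fin n))) : Prop :=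
  ∀ x ∈ S, ∃ (U : Set (EuclideanSpace ℝ (Fin n))) (g : EuclideanSpace ℝ (Fin n) → ℝ),
    IsOpen U ∧ x ∈ U ∧ ContDiffOn ℝ 1 g U ∧ (∀ y ∈ U, fderiv ℝ g y ≠ 0) ∧
      S ∩ U = {y ∈ U | g y = 0}

/-- `v` is an outward unit normal to the boundary of `D` at the boundary point `x`: a unit vector
orthogonal to all tangent vectors of `∂D` at `x`, which points out of `D` while `-v` points
into `D`. -/
def IsOutwardUnitNormal {n : ℕ} (D : Set (EuclideanSpace ℝ (Fin n)))
    (x v : EuclideanSpace ℝ (Fin n)) : Prop :=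
  ‖v‖ = 1 ∧ (∀ w ∈ tangentConeAt ℝ (frontier D) x, inner ℝ w v = 0) ∧
    ∀ᶠ t in 𝓝[>] (0 : ℝ), x + t • v ∉ closure D ∧ x - t • v ∈ D

/-- `D` is Lyapunov-Dini at `z ∈ ∂D`: in an open neighbourhood `V` of `z` the boundary is a
`C¹` manifold, with outward unit normal map `ν`, and `ν` is Dini-continuous at `z`. -/
def IsLyapunovDiniAt {n : ℕ} (D : Set (EuclideanSpace ℝ (Fin n)))
    (z : EuclideanSpace ℝ (Fin n)) : Prop :=
  z ∈ frontier D ∧ ∃ V : Set (EuclideanSpace ℝ (Fin n)), IsOpen V ∧ z ∈ V ∧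
    IsC1Hypersurface (frontier D ∩ V) ∧
    ∃ ν : EuclideanSpace ℝ (Fin n) → EuclideanSpace ℝ (Fin n),
      (∀ x ∈ frontier D ∩ V, IsOutwardUnitNormal D x (ν x)) ∧
      DiniContinuousAt ν (frontier D ∩ V) z

/-- The biggest ball centred at `x₀` and contained in `D` (for `D` open, bounded, `x₀ ∈ D`):
its radius is the distance from `x₀` to `∂D`. -/
def biggestBall {n : ℕ} (D : Set (EuclideanSpace ℝ (Fin n))) (x₀ : EuclideanSpace ℝ (Fin n)) :
    Set (EuclideanSpace ℝ (Fin n)) :=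
  Metric.ball x₀ (Metric.infDist x₀ (frontier D))

/-- The regular touching set `T(∂D, x₀)`. -/
def touchingSet {n : ℕ} (D : Set (EuclideanSpace ℝ (Fin n))) (x₀ : EuclideanSpace ℝ (Fin n)) :
    Set (EuclideanSpace ℝ (Fin n)) :=
  {z ∈ frontier D ∩ frontier (biggestBall D x₀) | IsLyapunovDiniAt D z}

/-- `h_α(x) = |α|^{n-2} (|x|² - |α|²) / |x - α|ⁿ`, used for `n ≥ 2`. -/
def hFun {n : ℕ} (α x : EuclideanSpace ℝ (Fin n)) : ℝ :=
  ‖α‖ ^ (n - 2) * ((‖x‖ ^ 2 - ‖α‖ ^ 2) / ‖x - α‖ ^ n)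

/-- The `α`-Kuran function `k_α = 1 + h_α`. -/
def kFun {n : ℕ} (α x : EuclideanSpace ℝ (Fin n)) : ℝ :=
  1 + hFun α x

/-- The filter of parameters `t → 1`, `t > 1`, with `t z ∉ closure D`: it describes the
points `α = t z` that tend radially to `z` from outside of `closure D`. -/
def radialFilter {n : ℕ} (D : Set (EuclideanSpace ℝ (Fin n))) (z : EuclideanSpace ℝ (Fin n)) :
    Filter ℝ :=
  𝓝[{t : ℝ | 1 < t ∧ t • z ∉ closure D}] 1

/-- `L(z) = liminf |k_α(0) - ⨍_{∂D} k_α dσ|` as `α` tends radially to `z` from outside,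
where `σ` is the `(n-1)`-dimensional Hausdorff measure. -/
def gapL {n : ℕ} (D : Set (EuclideanSpace ℝ (Fin n))) (z : EuclideanSpace ℝ (Fin n)) : ℝ≥0∞ :=
  liminf (fun t : ℝ => ENNReal.ofReal
    |kFun (t • z) 0 - ⨍ x in frontier D, kFun (t • z) x ∂μHE[n - 1]|) (radialFilter D z)

/-- `L*(z) = limsup ⨍_{∂D} |h_α| dσ` as `α` tends radially to `z` from outside. -/
def gapLStar {n : ℕ} (D : Set (EuclideanSpace ℝ (Fin n))) (z : EuclideanSpace ℝ (Fin n)) :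
    ℝ≥0∞ :=
  limsup (fun t : ℝ => ⨍⁻ x in frontier D, ENNReal.ofReal |hFun (t • z) x| ∂μHE[n - 1])
    (radialFilter D z)

/-- The translate `-x₀ + D`. -/
def translate {n : ℕ} (D : Set (EuclideanSpace ℝ (Fin n))) (x₀ : EuclideanSpace ℝ (Fin n)) :
    Set (EuclideanSpace ℝ (Fin n)) :=
  (fun x => -x₀ + x) '' D

/-- The Kuran gap `K(∂D, x₀)`: the infimum over the touching set (so `∞` if that set is empty)
of `L`, after translating `x₀` to the origin. -/
def kuranGap {n : ℕ} (D : Set (EuclideanSpace ℝ (Fin n))) (x₀ : EuclideanSpace ℝ (Fin n)) :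
    ℝ≥0∞ :=
  ⨅ z ∈ touchingSet (translate D x₀) 0, gapL (translate D x₀) z

/-- `h*(∂D, x₀)`: the infimum of `L*` over the touching set, after translating `x₀` to the
origin. -/
def hStar {n : ℕ} (D : Set (EuclideanSpace ℝ (Fin n))) (x₀ : EuclideanSpace ℝ (Fin n)) :
    ℝ≥0∞ :=
  ⨅ z ∈ touchingSet (translate D x₀) 0, gapLStar (translate D x₀) z

end

end KuranGap

/-! If the touching set is empty, the Kuran gap is an infimum over nothing, hence `⊤`. All other
claims follow from one estimate: for a touching point `z`, the integrals of `|h_α|` over `∂D` stay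
bounded as the pole `α = t z` tends to `z` (`exists_lintegral_hFun_le`). Since `k_α(0) = 0` and `k_α
= 1 + h_α`, this bounds both `L(z)` and `L*(z)`.

Away from `z` the kernel is bounded and `∂D` has finite area. Near `z` the inner ball forces the
normal at `z` to be `e = z/|z|`, and `∂D` lies in a Lipschitz graph over the hyperplane orthogonal
to `e`. Integrating the slope along a segment turns Dini continuity of the normal into the height
bound `|y| ≤ 4 ω(2p) p` at tangential distance `p` (`exists_local_graph`). With `R = |z|` and `τ =
|α - z|`, elementary geometry bounds `|h_α|` by a constant times `p^{-(n-2)} (R|y|/p² + 1 +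
Rτ/(p+τ)²)` (`abs_hFun_le_of_near`). Projecting to the hyperplane costs a factor `2^{n-1}` in area
(`exists_lintegral_le_of_graph`), and the polar Jacobian `p^{n-2}` cancels the singular power. What
remains is the Dini integral of `ω(2p)/p`, a constant, and a Poisson-type term of mass at most `1`,
all uniform in `τ`. -/

namespace KuranGap

/-! ### Normals, tangent cones and level sets as Lipschitz graphs. -/

section Geometry

variable {E : Type*} [NormedAddCommGroup E] [InnerProductSpace ℝ E]

/-- The ball is connected, and without frontier points `D` is both open and closed relative to it.
-/
theorem ball_subset_of_disjoint_frontier {D : Set E} {x₀ : E} {r : ℝ} (hD : IsOpen D)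
    (hx₀ : x₀ ∈ D) (hr : 0 < r) (h : Disjoint (Metric.ball x₀ r) (frontier D)) :
    Metric.ball x₀ r ⊆ D := by
  refine (convex_ball x₀ r).isPreconnected.subset_of_closure_inter_subset hD
    ⟨x₀, Metric.mem_ball_self hr, hx₀⟩ ?_
  rintro y ⟨hy, hyb⟩
  by_contra hyD
  exact h.le_bot ⟨hyb, by rw [hD.frontier_eq]; exact ⟨hy, hyD⟩⟩

/-- Every vector in the kernel of the derivative is tangent to the level set. -/
theorem mem_tangentConeAt_of_hasStrictFDerivAt [CompleteSpace E] {g : E → ℝ} {g' : E →L[ℝ] ℝ}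
    {x w : E} {s : Set E} (hg : HasStrictFDerivAt g g' x) (hg' : g' ≠ 0) (hw : g' w = 0)
    (hs : ∀ᶠ y in 𝓝 x, g y = g x → y ∈ s) : w ∈ tangentConeAt ℝ s x := by
  have hsurj : g'.range = ⊤ := by
    rw [LinearMap.range_eq_top]
    exact LinearMap.surjective (f := (g' : E →ₗ[ℝ] ℝ))
      (fun h => hg' (ContinuousLinearMap.coe_injective h))
  let u : g'.ker := ⟨w, hw⟩
  -- The implicit function maps the line `t • w` in the kernel to a curve in the level set with
  -- velocity `w` at `x`; its difference quotients exhibit `w` as tangent.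
  have hd : HasDerivAt (fun t : ℝ => hg.implicitFunction g g' hsurj (g x) (t • u)) w 0 := by
    have h0 : HasStrictFDerivAt (hg.implicitFunction g g' hsurj (g x)) g'.ker.subtypeL
        ((0 : ℝ) • u) := by
      rw [zero_smul]; exact hg.to_implicitFunction hsurj
    have h1 : HasDerivAt (fun t : ℝ => t • u) u 0 := by
      simpa using (hasDerivAt_id (0 : ℝ)).smul_const u
    exact h0.hasFDerivAt.comp_hasDerivAt 0 h1
  have h0 : hg.implicitFunction g g' hsurj (g x) ((0 : ℝ) • u) = x := by simp
  have hu : Tendsto (fun t : ℝ => t • u) (𝓝 0) (𝓝 0) := by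
    have hc : Continuous fun t : ℝ => t • u := continuous_id.smul continuous_const
    simpa using hc.tendsto 0
  have hx : Tendsto (fun t : ℝ => hg.implicitFunction g g' hsurj (g x) (t • u)) (𝓝 0) (𝓝 x) :=
    hg.tendsto_implicitFunction hsurj tendsto_const_nhds hu
  have hlev : ∀ᶠ t : ℝ in 𝓝 0, g (hg.implicitFunction g g' hsurj (g x) (t • u)) = g x :=
    (tendsto_const_nhds.prodMk_nhds hu).eventually (hg.map_implicitFunction_eq hsurj)
  refine mem_tangentConeAt_of_seq (𝓝[≠] (0 : ℝ)) (fun t => t⁻¹)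
    (fun t => hg.implicitFunction g g' hsurj (g x) (t • u) - x) ?_ ?_ ?_
  · simpa using (hx.sub_const x).mono_left nhdsWithin_le_nhds
  · refine Filter.Eventually.filter_mono nhdsWithin_le_nhds ?_
    filter_upwards [hlev, hx.eventually hs] with t h1 h2
    simpa using h2 h1
  · have := hasDerivAt_iff_tendsto_slope_zero.1 hd
    simpa [h0] using this

/-- A vector orthogonal to the kernel of a functional represents it up to a factor. -/
theorem exists_eq_mul_inner_of_kernel [CompleteSpace E] {g' : E →L[ℝ] ℝ} {v : E} (hv : v ≠ 0)
    (h : ∀ w, g' w = 0 → inner ℝ w v = 0) : ∃ c : ℝ, ∀ w, g' w = c * inner ℝ v w := by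
  refine ⟨g' v / inner ℝ v v, fun w => ?_⟩
  have hvv : inner ℝ v v ≠ (0 : ℝ) := by simpa using hv
  by_cases hgv : g' v = 0
  · exact absurd (h v hgv) hvv
  have := h (w - (g' w / g' v) • v) (by simp [hgv])
  rw [inner_sub_left, inner_smul_left, real_inner_comm] at this
  simp only [conj_trivial] at this
  field_simp at this ⊢
  linarith

/-- At a point of a level set closest to the origin the derivative is a multiple of the position
vector. -/
theorem exists_eq_mul_inner_of_norm_le [CompleteSpace E] {g : E → ℝ} {g' : E →L[ℝ] ℝ} {z : E}
    (hz : z ≠ 0) (hg : HasStrictFDerivAt g g' z)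
    (hmin : ∀ᶠ y in 𝓝 z, g y = g z → ‖z‖ ≤ ‖y‖) :
    ∃ c : ℝ, ∀ w, g' w = c * inner ℝ z w := by
  have hφ : HasStrictFDerivAt (fun x : E => ‖x‖ ^ 2) (2 • innerSL ℝ z) z :=
    (hasStrictFDerivAt_norm_sq z)
  have hloc : IsLocalExtrOn (fun x : E => ‖x‖ ^ 2) {x | g x = g z} z := by
    refine Or.inl ?_
    refine eventually_nhdsWithin_iff.2 ?_
    filter_upwards [hmin] with y hy hyz
    exact pow_le_pow_left₀ (norm_nonneg _) (hy hyz) 2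
  obtain ⟨a, b, hab, h⟩ := hloc.exists_multipliers_of_hasStrictFDerivAt_1d hg hφ
  have h' : ∀ w, a * g' w + b * (2 * inner ℝ z w) = 0 := fun w => by
    have := congrArg (fun f : E →L[ℝ] ℝ => f w) h
    simpa using this
  -- If `a = 0`, evaluating the multiplier relation at `z` gives `2 b |z|² = 0` with `b ≠ 0`.
  have ha : a ≠ 0 := by
    rintro rfl
    have := h' z
    have hb : b ≠ 0 := by rintro rfl; exact hab rfl
    simp [hb, hz] at this
  refine ⟨-(2 * b / a), fun w => ?_⟩
  have := h' w
  field_simp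
  linarith

/-- The outward unit normal at a boundary point of a ball inside the domain is radial. -/
theorem outward_normal_eq {D : Set E} {z v : E} (hz : z ≠ 0) (hv : ‖v‖ = 1)
    (hball : Metric.ball 0 ‖z‖ ⊆ D) (hout : ∀ᶠ t in 𝓝[>] (0 : ℝ), z + t • v ∉ closure D)
    {c : ℝ} (hc : z = c • v) : v = ‖z‖⁻¹ • z := by
  have hcn : ‖z‖ = |c| := by rw [hc, norm_smul, hv, mul_one, Real.norm_eq_abs]
  have hc0 : c ≠ 0 := by rintro rfl; simp [hz] at hcn
  rcases lt_or_gt_of_ne hc0 with h | h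
  -- If `v` pointed towards the origin, `z + t v` would enter the inner ball for small `t > 0`.
  · exfalso
    have h1 : ∀ᶠ t in 𝓝[>] (0 : ℝ), t < -c :=
      nhdsWithin_le_nhds (Iio_mem_nhds (by linarith))
    obtain ⟨t, ⟨ht, ht1⟩, ht0⟩ := ((hout.and h1).and self_mem_nhdsWithin).exists
    refine ht (subset_closure (hball ?_))
    have : z + t • v = (c + t) • v := by rw [add_smul, ← hc]
    rw [mem_ball_zero_iff, this, norm_smul, hv, mul_one, Real.norm_eq_abs, hcn, abs_of_neg h,
      abs_lt]
    have : (0 : ℝ) < t := ht0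
    constructor <;> linarith
  · rw [hcn, abs_of_pos h]
    conv_rhs => rw [hc]
    rw [smul_smul, inv_mul_cancel₀ hc0, one_smul]

/-- The component of `x` orthogonal to `e`. -/
def tangentialPart (e x : E) : E := x - (inner ℝ e x : ℝ) • e

theorem inner_tangentialPart {e : E} (he : ‖e‖ = 1) (x : E) :
    inner ℝ e (tangentialPart e x) = (0 : ℝ) := by
  simp [tangentialPart, inner_sub_right, inner_smul_right, he]

theorem norm_sq_eq_inner_add_tangentialPart {e : E} (he : ‖e‖ = 1) (x : E) :
    ‖x‖ ^ 2 = inner ℝ e x ^ 2 + ‖tangentialPart e x‖ ^ 2 := by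
  rw [tangentialPart, norm_sub_sq_real, inner_smul_right, norm_smul, he,
    real_inner_comm, mul_one, Real.norm_eq_abs, sq_abs]
  ring

theorem norm_tangentialPart_le {e : E} (he : ‖e‖ = 1) (x : E) : ‖tangentialPart e x‖ ≤ ‖x‖ := by
  refine le_of_sq_le_sq ?_ (norm_nonneg _)
  nlinarith [norm_sq_eq_inner_add_tangentialPart he x, sq_nonneg (inner ℝ e x : ℝ)]

theorem norm_le_inner_add_tangentialPart {e : E} (he : ‖e‖ = 1) (x : E) :
    ‖x‖ ≤ |inner ℝ e x| + ‖tangentialPart e x‖ := by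
  refine abs_le_of_sq_le_sq' ?_ (by positivity) |>.2
  nlinarith [norm_sq_eq_inner_add_tangentialPart he x, sq_abs (inner ℝ e x : ℝ),
    mul_nonneg (abs_nonneg (inner ℝ e x : ℝ)) (norm_nonneg (tangentialPart e x))]

/-- A set on which a function is close to the coordinate in the direction `e`. -/
def NearlyLinearOn (g : E → ℝ) (e : E) (s : Set E) : Prop :=
  ∀ x ∈ s, ∀ y ∈ s, |g x - g y - inner ℝ e (x - y)| ≤ 1 / 2 * ‖x - y‖

/-- Strict differentiability compares any two points near `z`, not only a point with `z`; this gives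
the graph property. -/
theorem exists_nearlyLinearOn {g : E → ℝ} {e z : E} (hg : HasStrictFDerivAt g (innerSL ℝ e) z) :
    ∃ δ > 0, NearlyLinearOn g e (Metric.ball z δ) := by
  obtain ⟨s, hs, h⟩ := hg.approximates_deriv_on_nhds (c := 1 / 2) (Or.inr (by norm_num))
  obtain ⟨δ, hδ, hsub⟩ := Metric.mem_nhds_iff.1 hs
  refine ⟨δ, hδ, fun x hx y hy => ?_⟩
  simpa using h x (hsub hx) y (hsub hy)

/-- Level sets are Lipschitz graphs over the hyperplane orthogonal to `e`. -/
theorem NearlyLinearOn.abs_inner_le {g : E → ℝ} {e : E} {s : Set E} (h : NearlyLinearOn g e s)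
    (he : ‖e‖ = 1) {x y : E} (hx : x ∈ s) (hy : y ∈ s) (hxy : g x = g y) :
    |inner ℝ e (x - y)| ≤ ‖tangentialPart e (x - y)‖ := by
  have h1 := h x hx y hy
  rw [hxy, sub_self, zero_sub, abs_neg] at h1
  -- With `a` the normal and `b` the tangential size, `a ≤ (a + b)/2` gives `a ≤ b`; this fixes the
  -- constant `1/2`.
  linarith [norm_le_inner_add_tangentialPart he (x - y)]

/-- The graph of a level set above a given point of the tangent hyperplane. -/
theorem NearlyLinearOn.exists_level {g : E → ℝ} {e z p : E} {δ : ℝ}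
    (h : NearlyLinearOn g e (Metric.ball z δ)) (hgc : ContinuousOn g (Metric.ball z δ))
    (he : ‖e‖ = 1) (hp : inner ℝ e p = (0 : ℝ)) {ρ : ℝ} (hpρ : ‖p‖ ≤ ρ) (hρ : 2 * ρ < δ) :
    ∃ y : ℝ, |y| ≤ ρ ∧ g (z + p + y • e) = g z := by
  have hρ0 : 0 ≤ ρ := (norm_nonneg p).trans hpρ
  have hmem : ∀ y : ℝ, |y| ≤ ρ → z + p + y • e ∈ Metric.ball z δ := fun y hy => by
    rw [mem_ball_iff_norm]
    calc ‖z + p + y • e - z‖ = ‖p + y • e‖ := by congr 1; abel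
      _ ≤ ‖p‖ + |y| := by simpa [norm_smul, he] using norm_add_le p (y • e)
      _ < δ := by linarith
  have hzmem : z ∈ Metric.ball z δ := by
    exact Metric.mem_ball_self (by linarith)
  -- The error is at most half of `2ρ`, so `g - g z` is `≤ 0` at height `-ρ` and `≥ 0` at height
  -- `ρ`.
  have key : ∀ y : ℝ, |y| ≤ ρ → |g (z + p + y • e) - g z - y| ≤ ρ := fun y hy => by
    have h1 := h _ (hmem y hy) z hzmem
    have h2 : z + p + y • e - z = p + y • e := by abel
    have h3 : ‖p + y • e‖ ≤ 2 * ρ := by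
      calc _ ≤ ‖p‖ + |y| := by simpa [norm_smul, he] using norm_add_le p (y • e)
        _ ≤ _ := by linarith
    rw [h2] at h1
    simp only [inner_add_right, hp, inner_smul_right, real_inner_self_eq_norm_sq, he, one_pow,
      mul_one, zero_add] at h1
    linarith
  have hcont : ContinuousOn (fun y : ℝ => g (z + p + y • e)) (Set.Icc (-ρ) ρ) :=
    hgc.comp (by fun_prop) fun y hy => hmem y (abs_le.2 hy)
  obtain ⟨y, hy, hgy⟩ := intermediate_value_Icc (by linarith) hcont
    (show g z ∈ Set.Icc _ _ from
      ⟨by linarith [(abs_le.1 (key (-ρ) (by rw [abs_neg, abs_of_nonneg hρ0]))).2],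
       by linarith [(abs_le.1 (key ρ (by rw [abs_of_nonneg hρ0]))).1]⟩)
  exact ⟨y, abs_le.2 hy, hgy⟩

/-- The slope of a curve in a level set is determined by the derivative of the function. -/
theorem hasDerivWithinAt_of_level {g : E → ℝ} {g' : E →L[ℝ] ℝ} {z p e : E} {y : ℝ → ℝ}
    {s₀ C : ℝ} {I : Set ℝ} (hg : HasFDerivAt g g' (z + s₀ • p + y s₀ • e)) (he : g' e ≠ 0)
    (hs₀ : s₀ ∈ I)
    (hlip : ∀ s ∈ I, |y s - y s₀| ≤ C * |s - s₀|)
    (hlev : ∀ s ∈ I, g (z + s • p + y s • e) = g z) :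
    HasDerivWithinAt y (-(g' p / g' e)) I s₀ := by
  have hyO : (fun s => y s - y s₀) =O[𝓝[I] s₀] fun s => s - s₀ :=
    Asymptotics.IsBigO.of_bound C (eventually_nhdsWithin_of_forall fun s hs => by
      simpa using hlip s hs)
  have hqO : (fun s => (z + s • p + y s • e) - (z + s₀ • p + y s₀ • e)) =O[𝓝[I] s₀]
      fun s => s - s₀ := by
    have h1 : (fun s => (s - s₀) • p) =O[𝓝[I] s₀] fun s => s - s₀ :=
      Asymptotics.IsBigO.of_bound ‖p‖ (Eventually.of_forall fun s => by
        rw [norm_smul, mul_comm])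
    have h2 : (fun s => (y s - y s₀) • e) =O[𝓝[I] s₀] fun s => s - s₀ :=
      (Asymptotics.IsBigO.of_bound ‖e‖ (Eventually.of_forall fun s => by
        rw [norm_smul, mul_comm])).trans hyO
    refine (h1.add h2).congr_left fun s => ?_
    rw [sub_smul, sub_smul]; abel
  have hqt : Tendsto (fun s => z + s • p + y s • e) (𝓝[I] s₀) (𝓝 (z + s₀ • p + y s₀ • e)) := by
    rw [tendsto_iff_norm_sub_tendsto_zero]
    refine (hqO.trans_tendsto ?_).norm.trans (by simp)
    exact (tendsto_sub_nhds_zero_iff.2 tendsto_id).mono_left nhdsWithin_le_nhds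
  -- The Lipschitz bound makes the remainder `o(s - s₀)`. As `g` is constant on the curve, dividing
  -- by `-g' e` isolates the increment of `y`.
  have hoo := (hg.isLittleO.comp_tendsto hqt).trans_isBigO hqO
  rw [hasDerivWithinAt_iff_isLittleO]
  have := hoo.const_mul_left (-(g' e)⁻¹)
  refine this.congr' (eventually_nhdsWithin_of_forall fun s hs => ?_) EventuallyEq.rfl
  have h2 : (z + s • p + y s • e) - (z + s₀ • p + y s₀ • e)
      = (s - s₀) • p + (y s - y s₀) • e := by
    rw [sub_smul, sub_smul]; abel
  simp only [Function.comp_apply, hlev s hs, hlev s₀ hs₀, h2, map_add, map_smul, smul_eq_mul]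
  field_simp
  ring

/-- The height of a level set above its tangent hyperplane, bounded through a modulus `M` for
its slope. -/
theorem height_le_of_slope_le {g : E → ℝ} {e z : E} {δ : ℝ} {M : ℝ → ℝ}
    (hg : NearlyLinearOn g e (Metric.ball z δ)) (he : ‖e‖ = 1)
    (hdiff : ∀ x ∈ Metric.ball z δ, DifferentiableAt ℝ g x)
    (hde : ∀ x ∈ Metric.ball z δ, 1 / 2 ≤ fderiv ℝ g x e)
    (hdz : fderiv ℝ g z = innerSL ℝ e)
    (hM : MonotoneOn M (Set.Ioi 0)) (hM0 : ∀ r, 0 < r → 0 ≤ M r)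
    (hslope : ∀ x ∈ Metric.ball z δ, g x = g z → x ≠ z → ∀ u, inner ℝ e u = (0 : ℝ) →
      |fderiv ℝ g x u| ≤ M ‖x - z‖ * ‖u‖)
    {x : E} (hx : 2 * ‖x - z‖ < δ) (hgx : g x = g z) :
    |inner ℝ e (x - z)| ≤ 2 * M (2 * ‖tangentialPart e (x - z)‖) * ‖tangentialPart e (x - z)‖ := by
  set p := tangentialPart e (x - z) with hp_def
  have hep : inner ℝ e p = (0 : ℝ) := inner_tangentialPart he _
  have hpx : ‖p‖ ≤ ‖x - z‖ := norm_tangentialPart_le he _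
  have hδ : 0 < δ := by linarith [norm_nonneg (x - z)]
  have hzb : z ∈ Metric.ball z δ := Metric.mem_ball_self hδ
  have hxb : x ∈ Metric.ball z δ := by rw [mem_ball_iff_norm]; linarith [norm_nonneg (x - z)]
  have hgc : ContinuousOn g (Metric.ball z δ) := fun x hx =>
    (hdiff x hx).continuousAt.continuousWithinAt
  -- The modulus `M` is controlled only at positive arguments, so `p = 0` is settled by the graph
  -- property.
  rcases (norm_nonneg p).eq_or_lt with hp0 | hp0
  · have := hg.abs_inner_le he hxb hzb hgx
    rw [← hp_def, ← hp0] at this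
    rwa [← hp0, mul_zero]
  -- `y s` will be the height of the level set above `z + s p`; it runs from `0` at `z` to the
  -- height of `x`, and the mean value inequality bounds the difference.
  have hex : ∀ s : ℝ, ∃ y : ℝ, s ∈ Set.Icc (0 : ℝ) 1 →
      |y| ≤ ‖p‖ ∧ g (z + s • p + y • e) = g z := fun s => by
    by_cases hs : s ∈ Set.Icc (0 : ℝ) 1
    · obtain ⟨y, hy⟩ := hg.exists_level hgc he (p := s • p) (ρ := ‖p‖)
        (by rw [inner_smul_right, hep, mul_zero])
        (by rw [norm_smul, Real.norm_eq_abs, abs_of_nonneg hs.1]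
            exact mul_le_of_le_one_left hp0.le hs.2) (by linarith)
      exact ⟨y, fun _ => hy⟩
    · exact ⟨0, fun h => absurd h hs⟩
  choose y hy using hex
  have hqn : ∀ s ∈ Set.Icc (0 : ℝ) 1, ‖z + s • p + y s • e - z‖ ≤ 2 * ‖p‖ := fun s hs => by
    calc ‖z + s • p + y s • e - z‖ = ‖s • p + y s • e‖ := by congr 1; abel
      _ ≤ s * ‖p‖ + |y s| := by
        simpa [norm_smul, he, abs_of_nonneg hs.1] using norm_add_le (s • p) (y s • e)
      _ ≤ 2 * ‖p‖ := by nlinarith [(hy s hs).1, hs.2]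
  have hqb : ∀ s ∈ Set.Icc (0 : ℝ) 1, z + s • p + y s • e ∈ Metric.ball z δ := fun s hs => by
    rw [mem_ball_iff_norm]; linarith [hqn s hs]
  have htp : ∀ a b : ℝ, tangentialPart e (a • p + b • e) = a • p := fun a b => by
    simp [tangentialPart, inner_add_right, inner_smul_right, hep, he]
  have hin : ∀ a b : ℝ, inner ℝ e (a • p + b • e) = b := fun a b => by
    simp [inner_add_right, inner_smul_right, hep, he]
  have hlip : ∀ s₀ ∈ Set.Icc (0 : ℝ) 1, ∀ s ∈ Set.Icc (0 : ℝ) 1,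
      |y s - y s₀| ≤ ‖p‖ * |s - s₀| := fun s₀ hs₀ s hs => by
    have := hg.abs_inner_le he (hqb s hs) (hqb s₀ hs₀) ((hy s hs).2.trans (hy s₀ hs₀).2.symm)
    rw [show (z + s • p + y s • e) - (z + s₀ • p + y s₀ • e)
      = (s - s₀) • p + (y s - y s₀) • e by rw [sub_smul, sub_smul]; abel, htp, hin,
      norm_smul, mul_comm] at this
    exact this
  have hy0 : y 0 = 0 := by
    have := hg.abs_inner_le he (hqb 0 (by simp)) hzb (hy 0 (by simp)).2
    rw [show (z + (0 : ℝ) • p + y 0 • e) - z = (0 : ℝ) • p + y 0 • e by abel, htp, hin,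
      zero_smul, norm_zero] at this
    exact abs_nonpos_iff.1 this
  have hxdec : x = z + (1 : ℝ) • p + (inner ℝ e (x - z) : ℝ) • e := by
    rw [hp_def, tangentialPart, one_smul]; abel
  have hy1 : y 1 = inner ℝ e (x - z) := by
    have := hg.abs_inner_le he (hqb 1 (by simp)) hxb ((hy 1 (by simp)).2.trans hgx.symm)
    have hdec : ∀ a : ℝ, x = z + (1 : ℝ) • p + a • e →
        (z + (1 : ℝ) • p + y 1 • e) - x = (0 : ℝ) • p + (y 1 - a) • e := fun a ha => by
      rw [ha, sub_smul, zero_smul]; abel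
    rw [hdec _ hxdec, htp, hin,
      zero_smul, norm_zero] at this
    exact sub_eq_zero.1 (abs_nonpos_iff.1 this)
  have hder : ∀ s ∈ Set.Icc (0 : ℝ) 1, HasDerivWithinAt y
      (-(fderiv ℝ g (z + s • p + y s • e) p / fderiv ℝ g (z + s • p + y s • e) e))
      (Set.Icc 0 1) s := fun s hs =>
    hasDerivWithinAt_of_level (hdiff _ (hqb s hs)).hasFDerivAt
      (ne_of_gt (lt_of_lt_of_le (by norm_num) (hde _ (hqb s hs)))) hs (hlip s hs) fun t ht => (hy t ht).2
  have hbound : ∀ s ∈ Set.Icc (0 : ℝ) 1,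
      ‖-(fderiv ℝ g (z + s • p + y s • e) p / fderiv ℝ g (z + s • p + y s • e) e)‖
        ≤ 2 * M (2 * ‖p‖) * ‖p‖ := fun s hs => by
    have hM2 : 0 ≤ M (2 * ‖p‖) := hM0 _ (by linarith)
    have hnum : |fderiv ℝ g (z + s • p + y s • e) p| ≤ M (2 * ‖p‖) * ‖p‖ := by
      by_cases hqz : z + s • p + y s • e = z
      -- The slope hypothesis excludes `z` itself, where the derivative kills `p` by orthogonality.
      · rw [hqz, hdz, innerSL_apply_apply, hep, abs_zero]; positivity
      · refine (hslope _ (hqb s hs) (hy s hs).2 hqz p hep).trans ?_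
        have h0 : 0 < ‖z + s • p + y s • e - z‖ := norm_pos_iff.2 (sub_ne_zero.2 hqz)
        exact mul_le_mul_of_nonneg_right (hM h0 (show (0 : ℝ) < 2 * ‖p‖ by linarith) (hqn s hs))
          hp0.le
    have hde' := hde _ (hqb s hs)
    rw [norm_neg, norm_div, Real.norm_eq_abs, Real.norm_eq_abs,
      abs_of_pos (show 0 < fderiv ℝ g (z + s • p + y s • e) e by linarith),
      div_le_iff₀ (by linarith)]
    have : 0 ≤ M (2 * ‖p‖) * ‖p‖ := by positivity
    nlinarith
  have := (convex_Icc (0 : ℝ) 1).norm_image_sub_le_of_norm_hasDerivWithin_le hder hbound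
    (Set.left_mem_Icc.2 zero_le_one) (Set.right_mem_Icc.2 zero_le_one)
  simpa [hy0, hy1] using this

end Geometry

/-! ### Surface integrals bounded by integrals over the tangent hyperplane. -/

section HausdorffMeasure

open Module

/-- A map that is antilipschitz on `S` pushes the area of `S` to a measure dominated by the area
of the target. -/
theorem map_restrict_euclideanHausdorffMeasure_le {X Y : Type*} [MetricSpace X]
    [MeasurableSpace X] [BorelSpace X] [MetricSpace Y] [MeasurableSpace Y] [BorelSpace Y]
    {f : X → Y} (hf : Measurable f) {S : Set X} {C : NNReal}
    (h : ∀ x ∈ S, ∀ y ∈ S, dist x y ≤ C * dist (f x) (f y)) (d : ℕ) :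
    ((μHE[d] : Measure X).restrict S).map f ≤ (C ^ d : NNReal) • (μHE[d] : Measure Y) := by
  have hanti : AntilipschitzWith C (fun x : S => f x) :=
    AntilipschitzWith.of_le_mul_dist fun x y => h x x.2 y y.2
  refine Measure.le_iff.2 fun A hA => ?_
  rw [Measure.map_apply hf hA, Measure.restrict_apply (hf hA)]
  have h1 : f ⁻¹' A ∩ S = Subtype.val '' ((fun x : S => f x) ⁻¹' A) := by
    ext x
    simp only [Set.mem_inter_iff, Set.mem_preimage, Set.mem_image, Subtype.exists,
      exists_and_left, exists_prop, exists_eq_right_right]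
  rw [h1, isometry_subtype_coe.euclideanHausdorffMeasure_image]
  have h2 := hanti.hausdorffMeasure_preimage_le (d := d) (Nat.cast_nonneg d) A
  simp only [Measure.euclideanHausdorffMeasure_def, Measure.smul_apply]
  -- Both normalised measures carry the same dimensional factor, so only the plain Hausdorff
  -- measures need comparing.
  rw [smul_comm]
  gcongr
  simpa [ENNReal.smul_def] using h2

variable {E : Type*} [NormedAddCommGroup E] [InnerProductSpace ℝ E]

theorem norm_orthogonalProjectionOnto_eq [FiniteDimensional ℝ E] {e : E} (he : ‖e‖ = 1) (x : E) :
    ‖(ℝ ∙ e)ᗮ.orthogonalProjectionOnto x‖ = ‖tangentialPart e x‖ := by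
  rw [Submodule.coe_norm, ← Submodule.starProjection_apply,
    Submodule.starProjection_orthogonal_val, Submodule.starProjection_unit_singleton ℝ he]
  rfl

/-- Integration of a radial function in polar coordinates. -/
theorem lintegral_ofReal_norm_eq [MeasurableSpace E] [BorelSpace E] [FiniteDimensional ℝ E]
    [Nontrivial E] {f : ℝ → ℝ} (hf : ∀ r, 0 ≤ f r)
    (hfi : IntegrableOn (fun r => r ^ (finrank ℝ E - 1) * f r) (Set.Ioi 0)) :
    ∫⁻ x : E, ENNReal.ofReal (f ‖x‖) = ENNReal.ofReal (finrank ℝ E *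
      ((volume : Measure E).real (Metric.ball 0 1) *
        ∫ r in Set.Ioi (0 : ℝ), r ^ (finrank ℝ E - 1) * f r)) := by
  have hint : Integrable (fun x : E => f ‖x‖) := by
    rw [integrable_fun_norm_addHaar]
    simpa using hfi
  rw [← ofReal_integral_eq_lintegral_ofReal hint (Eventually.of_forall fun x => hf _),
    integral_fun_norm_addHaar]
  simp

/-- Integrals over a piece of a Lipschitz graph of functions dominated by a radial one. -/
theorem exists_lintegral_le_of_graph [MeasurableSpace E] [BorelSpace E] [FiniteDimensional ℝ E]
    {d : ℕ} (hd : finrank ℝ E = d + 1) (hd1 : 1 ≤ d) {e : E} (he : ‖e‖ = 1) :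
    ∃ C : NNReal, ∀ (z : E) (S : Set E), z ∈ S → MeasurableSet S →
      (∀ x ∈ S, ∀ y ∈ S, |inner ℝ e (x - y)| ≤ ‖tangentialPart e (x - y)‖) →
      ∀ (f : ℝ → ℝ), (∀ r, 0 ≤ f r) → IntegrableOn (fun r => r ^ (d - 1) * f r) (Set.Ioi 0) →
      ∀ F : E → ℝ≥0∞,
        (∀ x ∈ S, x ≠ z → F x ≤ ENNReal.ofReal (f ‖tangentialPart e (x - z)‖)) →
        ∫⁻ x in S, F x ∂μHE[d] ≤
          C * ENNReal.ofReal (∫ r in Set.Ioi (0 : ℝ), r ^ (d - 1) * f r) := by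
  have he0 : e ≠ 0 := by rintro rfl; simp at he
  have : Fact (finrank ℝ E = d + 1) := ⟨hd⟩
  have hK : finrank ℝ (ℝ ∙ e)ᗮ = d := Submodule.finrank_orthogonal_span_singleton he0
  have : Nontrivial (ℝ ∙ e)ᗮ := Module.nontrivial_of_finrank_pos (R := ℝ) (by omega)
  -- The factor `2 ^ d` comes from the antilipschitz projection, the other from polar coordinates in
  -- dimension `d`.
  refine ⟨2 ^ d * Real.toNNReal (d * (volume : Measure (ℝ ∙ e)ᗮ).real (Metric.ball 0 1)),
    fun z S hz hS hlip f hf hfi F hF => ?_⟩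
  set P : E → (ℝ ∙ e)ᗮ := fun x => (ℝ ∙ e)ᗮ.orthogonalProjectionOnto (x - z) with hP
  have hPm : Measurable P := by
    have : Continuous P := by fun_prop
    exact this.measurable
  have hPn : ∀ x, ‖P x‖ = ‖tangentialPart e (x - z)‖ := fun x =>
    norm_orthogonalProjectionOnto_eq he _
  have hanti : ∀ x ∈ S, ∀ y ∈ S, dist x y ≤ (2 : NNReal) * dist (P x) (P y) := fun x hx y hy => by
    have h1 : P x - P y = (ℝ ∙ e)ᗮ.orthogonalProjectionOnto (x - y) := by
      rw [hP, ← map_sub]; congr 1; abel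
    rw [dist_eq_norm, dist_eq_norm, h1, norm_orthogonalProjectionOnto_eq he]
    have := norm_le_inner_add_tangentialPart he (x - y)
    have := hlip x hx y hy
    push_cast
    linarith
  have hmap := map_restrict_euclideanHausdorffMeasure_le hPm hanti d
  have hvol : (μHE[d] : Measure (ℝ ∙ e)ᗮ) = volume := by
    have := InnerProductSpace.euclideanHausdorffMeasure_eq_volume (V := (ℝ ∙ e)ᗮ)
    rwa [hK] at this
  rw [hvol] at hmap
  have hint : Integrable (fun x : (ℝ ∙ e)ᗮ => f ‖x‖) := by
    rw [integrable_fun_norm_addHaar, hK]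
    simpa using hfi
  -- Absolute continuity serves twice: `z` becomes negligible, and a.e. measurability of the radial
  -- function transfers from `volume`.
  have hac : ((μHE[d] : Measure E).restrict S).map P ≪ volume :=
    (Measure.absolutelyContinuous_of_le hmap).trans (Measure.smul_absolutelyContinuous)
  have hPz : ∀ᵐ x ∂((μHE[d] : Measure E).restrict S), x ≠ z := by
    have h0 : ∀ᵐ y : (ℝ ∙ e)ᗮ ∂((μHE[d] : Measure E).restrict S).map P, y ≠ 0 :=
      hac.ae_le (Measure.ae_ne volume 0)
    filter_upwards [ae_of_ae_map hPm.aemeasurable h0] with x hx hxz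
    exact hx (by simp [hP, hxz])
  calc ∫⁻ x in S, F x ∂μHE[d]
      ≤ ∫⁻ x in S, ENNReal.ofReal (f ‖P x‖) ∂μHE[d] := by
        refine lintegral_mono_ae ?_
        filter_upwards [hPz, ae_restrict_mem hS] with x h1 h2
        rw [hPn]
        exact hF x h2 h1
    _ = ∫⁻ y, ENNReal.ofReal (f ‖y‖) ∂((μHE[d] : Measure E).restrict S).map P := by
        rw [lintegral_map' _ hPm.aemeasurable]
        exact hint.aestronglyMeasurable.aemeasurable.ennreal_ofReal.mono_ac hac
    _ ≤ ∫⁻ y, ENNReal.ofReal (f ‖y‖) ∂(((2 : NNReal) ^ d : NNReal) • (volume : Measure (ℝ ∙ e)ᗮ)) :=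
        lintegral_mono' hmap le_rfl
    _ = _ := by
        rw [lintegral_smul_measure, lintegral_ofReal_norm_eq hf (by rwa [hK]), hK, ← mul_assoc,
          ENNReal.ofReal_mul (by positivity), ENNReal.smul_def, smul_eq_mul, ← mul_assoc]
        simp [ENNReal.ofReal]

end HausdorffMeasure

/-! ### One-dimensional radial integrals. -/

section Radial

/-- The antiderivative `-τ/(r + τ)` starts at `-1` and stays negative. The bound is uniform in `τ`,
as needed when the pole approaches the boundary. -/
theorem integral_div_add_sq_le {δ τ : ℝ} (hδ : 0 < δ) (hτ : 0 < τ) :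
    IntegrableOn (fun r : ℝ => τ / (r + τ) ^ 2) (Set.Ioo 0 δ) ∧
      ∫ r in Set.Ioo 0 δ, τ / (r + τ) ^ 2 ≤ 1 := by
  have hcont : ContinuousOn (fun r : ℝ => τ / (r + τ) ^ 2) (Set.uIcc 0 δ) := by
    rw [Set.uIcc_of_le hδ.le]
    refine continuousOn_const.div (by fun_prop) fun r hr => ?_
    have := hr.1
    positivity
  have hi : IntervalIntegrable (fun r : ℝ => τ / (r + τ) ^ 2) volume 0 δ :=
    hcont.intervalIntegrable
  refine ⟨(hi.1).mono_set Set.Ioo_subset_Ioc_self, ?_⟩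
  rw [← integral_Ioc_eq_integral_Ioo, ← intervalIntegral.integral_of_le hδ.le,
    intervalIntegral.integral_eq_sub_of_hasDerivAt (f := fun r => -(τ / (r + τ))) _ hi]
  · have : 0 ≤ τ / (δ + τ) := by positivity
    simp [hτ.ne', this]
  · intro r hr
    rw [Set.uIcc_of_le hδ.le] at hr
    have hne : r + τ ≠ 0 := by linarith [hr.1]
    have h := ((((hasDerivAt_id r).add_const τ).fun_inv hne).const_mul (-τ)).congr_deriv
      (show _ = τ / (r + τ) ^ 2 by simp only [id]; ring)
    exact h.congr_of_eventuallyEq (Eventually.of_forall fun r => by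
      simp only [id]; ring)

theorem IsDiniFunction.integrableOn_comp_two_mul {ω : ℝ → ℝ} (hω : IsDiniFunction ω) {δ : ℝ}
    (hδ : 0 < δ) : IntegrableOn (fun r => ω (2 * r) / r) (Set.Ioo 0 δ) := by
  have h := hω.integrableOn (2 * δ) (by positivity)
  rw [← intervalIntegrable_iff_integrableOn_Ioo_of_le (by positivity)] at h ⊢
  have := (h.comp_mul_left (c := 2)).const_mul 2
  simp only [zero_div, mul_div_cancel_left₀ _ (two_ne_zero' ℝ)] at this
  refine this.congr fun r _ => ?_
  field_simp

end Radial

/-! ### The boundary near a regular touching point. -/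

section LocalGraph

variable {n : ℕ} {D : Set (EuclideanSpace ℝ (Fin n))} {z : EuclideanSpace ℝ (Fin n)}

theorem norm_eq_infDist_of_mem_touchingSet (hD : IsOpen D) (h0 : 0 ∈ D)
    (hz : z ∈ touchingSet D 0) :
    0 < ‖z‖ ∧ ‖z‖ = Metric.infDist 0 (frontier D) := by
  have h0f : (0 : EuclideanSpace ℝ (Fin n)) ∉ frontier D := fun h => by
    rw [hD.frontier_eq] at h; exact h.2 h0
  have hpos : 0 < Metric.infDist 0 (frontier D) :=
    (isClosed_frontier.notMem_iff_infDist_pos ⟨z, hz.1.1⟩).1 h0f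
  have h := hz.1.2
  rw [biggestBall, frontier_ball _ hpos.ne', mem_sphere_zero_iff_norm] at h
  exact ⟨h ▸ hpos, h⟩

theorem norm_le_of_mem_frontier (hD : IsOpen D) (h0 : 0 ∈ D) (hz : z ∈ touchingSet D 0)
    {y : EuclideanSpace ℝ (Fin n)} (hy : y ∈ frontier D) : ‖z‖ ≤ ‖y‖ := by
  rw [(norm_eq_infDist_of_mem_touchingSet hD h0 hz).2, ← dist_zero_left]
  exact Metric.infDist_le_dist_of_mem hy

theorem ball_subset_of_mem_touchingSet (hD : IsOpen D) (h0 : 0 ∈ D) (hz : z ∈ touchingSet D 0) :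
    Metric.ball 0 ‖z‖ ⊆ D := by
  refine ball_subset_of_disjoint_frontier hD h0
    (norm_eq_infDist_of_mem_touchingSet hD h0 hz).1 (Set.disjoint_left.2 fun y hy hyf => ?_)
  rw [mem_ball_zero_iff] at hy
  exact hy.not_ge (norm_le_of_mem_frontier hD h0 hz hyf)

/-- The derivative of a local defining function of the boundary is a multiple of the normal. -/
theorem exists_eq_mul_inner_normal {g : EuclideanSpace ℝ (Fin n) → ℝ}
    {g' : EuclideanSpace ℝ (Fin n) →L[ℝ] ℝ} {x v : EuclideanSpace ℝ (Fin n)}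
    (hg : HasStrictFDerivAt g g' x) (hg' : g' ≠ 0) (hv : IsOutwardUnitNormal D x v)
    (hlev : ∀ᶠ y in 𝓝 x, g y = g x → y ∈ frontier D) :
    ∃ c : ℝ, ∀ w, g' w = c * inner ℝ v w :=
  exists_eq_mul_inner_of_kernel (by rintro rfl; simpa using hv.1) fun w hw =>
    hv.2.1 w (mem_tangentConeAt_of_hasStrictFDerivAt hg hg' hw hlev)

/-- The derivative `g'` is a multiple of `v`, by tangency, and of `z`, by minimality of `|z|` on the
boundary. So `v` and `z` are parallel, and the inner ball fixes the sign. -/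
theorem normal_eq_of_mem_touchingSet (hD : IsOpen D) (h0 : 0 ∈ D) (hz : z ∈ touchingSet D 0)
    {g : EuclideanSpace ℝ (Fin n) → ℝ} {g' : EuclideanSpace ℝ (Fin n) →L[ℝ] ℝ}
    {v : EuclideanSpace ℝ (Fin n)}
    (hg : HasStrictFDerivAt g g' z) (hg' : g' ≠ 0) (hv : IsOutwardUnitNormal D z v)
    (hlev : ∀ᶠ y in 𝓝 z, g y = g z → y ∈ frontier D) : v = ‖z‖⁻¹ • z := by
  have hz0 : z ≠ 0 := norm_pos_iff.1 (norm_eq_infDist_of_mem_touchingSet hD h0 hz).1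
  obtain ⟨c, hc⟩ := exists_eq_mul_inner_normal hg hg' hv hlev
  obtain ⟨b, hb⟩ := exists_eq_mul_inner_of_norm_le hz0 hg
    (hlev.mono fun y hy hyz => norm_le_of_mem_frontier hD h0 hz (hy hyz))
  have hb0 : b ≠ 0 := by
    rintro rfl
    exact hg' (ContinuousLinearMap.ext fun w => by simp [hb w])
  refine outward_normal_eq hz0 hv.1 (ball_subset_of_mem_touchingSet hD h0 hz)
    (hv.2.2.mono fun t ht => ht.1) (c := c / b) ?_
  refine ext_inner_right ℝ fun w => ?_
  have := (hb w).symm.trans (hc w)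
  rw [real_inner_smul_left]
  field_simp
  linarith

/-- Near a regular touching point, the boundary is a Lipschitz graph over its tangent hyperplane
whose height is controlled by a Dini function. -/
theorem exists_local_graph (hD : IsOpen D) (h0 : 0 ∈ D) (hz : z ∈ touchingSet D 0) :
    (∀ᶠ t in 𝓝[>] (0 : ℝ), z + t • (‖z‖⁻¹ • z) ∉ closure D) ∧
    ∃ ω : ℝ → ℝ, IsDiniFunction ω ∧ ∃ δ > 0,
      (∀ x ∈ frontier D ∩ Metric.ball z δ, ∀ y ∈ frontier D ∩ Metric.ball z δ,
        |inner ℝ (‖z‖⁻¹ • z) (x - y)| ≤ ‖tangentialPart (‖z‖⁻¹ • z) (x - y)‖) ∧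
      ∀ x ∈ frontier D ∩ Metric.ball z δ, |inner ℝ (‖z‖⁻¹ • z) (x - z)| ≤
        4 * ω (2 * ‖tangentialPart (‖z‖⁻¹ • z) (x - z)‖) *
          ‖tangentialPart (‖z‖⁻¹ • z) (x - z)‖ := by
  have hzpos := (norm_eq_infDist_of_mem_touchingSet hD h0 hz).1
  set e := ‖z‖⁻¹ • z with he_def
  have he : ‖e‖ = 1 := by
    rw [he_def, norm_smul, norm_inv, norm_norm, inv_mul_cancel₀ hzpos.ne']
  obtain ⟨hzf, V, hV, hzV, hsurf, ν, hν, ω, hω, δ₁, hδ₁, hdini⟩ := hz.2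
  obtain ⟨U, g, hU, hzU, hgU, hgne, hSU⟩ := hsurf z ⟨hzf, hzV⟩
  have hW : IsOpen (U ∩ V) := hU.inter hV
  have hmem : ∀ y ∈ U ∩ V, (y ∈ frontier D ↔ g y = 0) := fun y hy => by
    have := Set.ext_iff.1 hSU y
    simp only [Set.mem_inter_iff, Set.mem_ofPred_eq, hy.1, hy.2, and_true, true_and] at this
    exact this
  have hstrict : ∀ y ∈ U, HasStrictFDerivAt g (fderiv ℝ g y) y := fun y hy =>
    (hgU.contDiffAt (hU.mem_nhds hy)).hasStrictFDerivAt (by simp)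
  have hlev : ∀ x ∈ U ∩ V, g x = 0 → ∀ᶠ y in 𝓝 x, g y = g x → y ∈ frontier D :=
    fun x hx hgx => by
      filter_upwards [hW.mem_nhds hx] with y hy hyx
      exact (hmem y hy).2 (hyx.trans hgx)
  have hgz : g z = 0 := (hmem z ⟨hzU, hzV⟩).1 hzf
  have hνz : ν z = e := normal_eq_of_mem_touchingSet hD h0 hz (hstrict z hzU) (hgne z hzU)
    (hν z ⟨hzf, hzV⟩) (hlev z ⟨hzU, hzV⟩ hgz)
  refine ⟨?_, ω, hω, ?_⟩
  · have := (hν z ⟨hzf, hzV⟩).2.2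
    rw [hνz] at this
    exact this.mono fun t ht => ht.1
  obtain ⟨c, hc⟩ := exists_eq_mul_inner_normal (hstrict z hzU) (hgne z hzU)
    (hν z ⟨hzf, hzV⟩) (hlev z ⟨hzU, hzV⟩ hgz)
  rw [hνz] at hc
  have hc0 : c ≠ 0 := by
    rintro rfl
    exact hgne z hzU (ContinuousLinearMap.ext fun w => by simp [hc w])
  -- Rescaling by `c⁻¹` makes the gradient at `z` equal to the unit vector `e`.
  have hGd : ∀ y ∈ U, fderiv ℝ (c⁻¹ • g) y = c⁻¹ • fderiv ℝ g y := fun y hy =>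
    fderiv_const_smul (hstrict y hy).differentiableAt _
  have hGz : fderiv ℝ (c⁻¹ • g) z = innerSL ℝ e := by
    rw [hGd z hzU]
    ext w
    simp [hc w, hc0]
  have hGs : HasStrictFDerivAt (c⁻¹ • g) (innerSL ℝ e) z := by
    rw [← hGz, hGd z hzU]
    exact (hstrict z hzU).const_smul _
  obtain ⟨δ₂, hδ₂, hlin⟩ := exists_nearlyLinearOn hGs
  obtain ⟨δ₃, hδ₃, hδW⟩ := Metric.isOpen_iff.1 hW z ⟨hzU, hzV⟩
  have hcont : ContinuousAt (fun y => c⁻¹ • fderiv ℝ g y) z :=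
    ((hgU.continuousOn_fderiv_of_isOpen hU (by simp)).continuousAt
      (hU.mem_nhds hzU)).fun_const_smul c⁻¹
  obtain ⟨δ₄, hδ₄, hclose⟩ := Metric.continuousAt_iff.1 hcont (1 / 2) (by norm_num)
  obtain ⟨δ, hδ, hδ1, hδ2, hδ3, hδ4⟩ : ∃ δ > 0, δ ≤ δ₁ ∧ δ ≤ δ₂ ∧ δ ≤ δ₃ ∧ δ ≤ δ₄ :=
    ⟨min (min δ₁ δ₂) (min δ₃ δ₄), by positivity, by simp, by simp, by simp, by simp⟩
  have hballW : Metric.ball z δ ⊆ U ∩ V := (Metric.ball_subset_ball hδ3).trans hδW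
  have hlin' : NearlyLinearOn (c⁻¹ • g) e (Metric.ball z δ) := fun x hx y hy =>
    hlin x (Metric.ball_subset_ball hδ2 hx) y (Metric.ball_subset_ball hδ2 hy)
  have hnear : ∀ x ∈ Metric.ball z δ, ‖fderiv ℝ (c⁻¹ • g) x - innerSL ℝ e‖ ≤ 1 / 2 :=
    fun x hx => by
      have := hclose (Metric.ball_subset_ball hδ4 hx)
      rw [← hGd x (hballW hx).1, ← hGd z hzU, hGz, dist_eq_norm] at this
      exact this.le
  have hzero : ∀ x ∈ frontier D ∩ Metric.ball z δ, (c⁻¹ • g) x = (c⁻¹ • g) z := fun x hx => by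
    simp [hgz, (hmem x (hballW hx.2)).1 hx.1]
  have hhalf : Metric.ball z (δ / 2) ⊆ Metric.ball z δ := Metric.ball_subset_ball (by linarith)
  refine ⟨δ / 2, by positivity, fun x hx y hy => ?_, fun x hx => ?_⟩
  · exact hlin'.abs_inner_le he (hhalf hx.2) (hhalf hy.2)
      ((hzero x ⟨hx.1, hhalf hx.2⟩).trans (hzero y ⟨hy.1, hhalf hy.2⟩).symm)
  -- The factor `2` bounds the norm of the rescaled derivative; the height estimate doubles it to
  -- the final `4`.
  · have key := height_le_of_slope_le (M := fun r => 2 * ω r) (x := x) hlin' he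
      (fun y hy => (hstrict y (hballW hy).1).differentiableAt.const_smul _)
      (fun y hy => ?_) hGz (fun a ha b hb hab => ?_) (fun r hr => ?_) (fun y hy hgy hyz u hu => ?_)
      ?_ (hzero x ⟨hx.1, hhalf hx.2⟩)
    · refine key.trans (le_of_eq ?_); ring
    · have h1 := (fderiv ℝ (c⁻¹ • g) y - innerSL ℝ e).le_of_opNorm_le (hnear y hy) e
      rw [he, Real.norm_eq_abs, sub_apply, innerSL_apply_apply,
        real_inner_self_eq_norm_sq, he] at h1
      linarith [(abs_le.1 h1).1]
    · exact mul_le_mul_of_nonneg_left (hω.monotoneOn ha hb hab) zero_le_two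
    · exact mul_nonneg zero_le_two (hω.pos r hr).le
    · have hyf : y ∈ frontier D := (hmem y (hballW hy)).2 (by simpa [hgz, hc0] using hgy)
      have hyS : y ∈ frontier D ∩ V := ⟨hyf, (hballW hy).2⟩
      obtain ⟨a, ha⟩ := exists_eq_mul_inner_normal (hstrict y (hballW hy).1)
        (hgne y (hballW hy).1) (hν y hyS)
        (hlev y (hballW hy) ((hmem y (hballW hy)).1 hyf))
      have hG : ∀ w, fderiv ℝ (c⁻¹ • g) y w = c⁻¹ * a * inner ℝ (ν y) w := fun w => by
        rw [hGd y (hballW hy).1, smul_apply, ha, smul_eq_mul, mul_assoc]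
      have hnorm : ‖fderiv ℝ (c⁻¹ • g) y‖ ≤ 2 := by
        have h1 := norm_le_norm_add_norm_sub' (fderiv ℝ (c⁻¹ • g) y) (innerSL ℝ e)
        rw [innerSL_apply_norm, he] at h1
        linarith [hnear y hy]
      have hca : |c⁻¹ * a| ≤ 2 := by
        have h1 := (fderiv ℝ (c⁻¹ • g) y).le_of_opNorm_le hnorm (ν y)
        rw [hG, real_inner_self_eq_norm_sq, (hν y hyS).1] at h1
        simpa using h1
      have hd : ‖ν y - ν z‖ ≤ ω ‖y - z‖ := hdini y hyS (norm_pos_iff.2 (sub_ne_zero.2 hyz))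
        (by rw [← mem_ball_iff_norm]; exact Metric.ball_subset_ball hδ1 hy)
      -- Since `u` is orthogonal to `ν z = e`, only the oscillation of the normal contributes to the
      -- slope.
      have hin : inner ℝ (ν y) u = inner ℝ (ν y - ν z) u := by
        rw [inner_sub_left, hνz, hu, sub_zero]
      rw [hG, abs_mul, hin]
      have h2 := (abs_real_inner_le_norm (ν y - ν z) u).trans
        (mul_le_mul_of_nonneg_right hd (norm_nonneg u))
      calc _ ≤ 2 * (ω ‖y - z‖ * ‖u‖) := mul_le_mul hca h2 (abs_nonneg _) zero_le_two
        _ = _ := by ring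
    · have := hx.2
      rw [mem_ball_iff_norm] at this
      linarith

end LocalGraph

/-! ### Uniform bounds for the kernel and its boundary integrals. -/

section KernelBounds

variable {n : ℕ}

/-- Bound of the kernel away from its pole. -/
theorem abs_hFun_le_of_far {α x : EuclideanSpace ℝ (Fin n)} {A B r : ℝ} (hA : ‖α‖ ≤ A)
    (hB : ‖x‖ ≤ B) (hr : 0 < r) (hx : r ≤ ‖x - α‖) :
    |hFun α x| ≤ A ^ (n - 2) * ((B ^ 2 + A ^ 2) / r ^ n) := by
  have hA0 : 0 ≤ A := (norm_nonneg α).trans hA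
  rw [hFun, abs_mul, abs_div, abs_of_nonneg (by positivity : 0 ≤ ‖α‖ ^ (n - 2)),
    abs_of_nonneg (by positivity : 0 ≤ ‖x - α‖ ^ n)]
  have : |‖x‖ ^ 2 - ‖α‖ ^ 2| ≤ B ^ 2 + A ^ 2 := by
    have h1 := pow_le_pow_left₀ (norm_nonneg x) hB 2
    have h2 := pow_le_pow_left₀ (norm_nonneg α) hA 2
    rw [abs_le]
    constructor <;> nlinarith [sq_nonneg ‖x‖, sq_nonneg ‖α‖]
  gcongr

/-- Bound of the kernel near a touching point in terms of the height over the tangent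
hyperplane. -/
theorem abs_hFun_le_of_near (hn : 2 ≤ n) {e x : EuclideanSpace ℝ (Fin n)} (he : ‖e‖ = 1)
    {R τ p y : ℝ} (hτ : 0 < τ) (hτR : τ ≤ R) (hp0 : 0 < p)
    (hp : ‖tangentialPart e (x - R • e)‖ = p) (hy : inner ℝ e (x - R • e) = y) (hyp : |y| ≤ p) :
    |hFun ((R + τ) • e) x| ≤ (2 * R) ^ (n - 2) * 3 ^ n *
      ((p ^ (n - 2))⁻¹ * (2 * R * |y| / p ^ 2 + 2 + 3 * R * (τ / (p + τ) ^ 2))) := by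
  have hR : 0 < R := hτ.trans_le hτR
  have hα : ‖(R + τ) • e‖ = R + τ := by
    rw [norm_smul, he, mul_one, Real.norm_eq_abs, abs_of_pos (by linarith)]
  have htp : ∀ a b : ℝ, tangentialPart e (x - a • e) = tangentialPart e (x - b • e) := fun a b => by
    simp only [tangentialPart, inner_sub_right, inner_smul_right, real_inner_self_eq_norm_sq, he]
    module
  have hin : ∀ a : ℝ, inner ℝ e (x - a • e) = inner ℝ e x - a := fun a => by
    simp [inner_sub_right, inner_smul_right, he]
  have hx2 : ‖x‖ ^ 2 = (R + y) ^ 2 + p ^ 2 := by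
    have h1 := norm_sq_eq_inner_add_tangentialPart he x
    have h2 := htp 0 R
    rw [zero_smul, sub_zero] at h2
    rw [h1, h2, hp, ← hy, hin]; ring
  have hxα2 : ‖x - (R + τ) • e‖ ^ 2 = (y - τ) ^ 2 + p ^ 2 := by
    have h1 := norm_sq_eq_inner_add_tangentialPart he (x - (R + τ) • e)
    rw [h1, htp _ R, hp, ← hy, hin, hin]; ring
  -- Both `p` and `τ - y` are at most the distance, and `y ≤ p`; hence `p + τ = p + (τ - y) + y` is
  -- at most three distances.
  have hlow : (p + τ) / 3 ≤ ‖x - (R + τ) • e‖ := by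
    have h1 : p ≤ ‖x - (R + τ) • e‖ :=
      abs_le_of_sq_le_sq' (by nlinarith [sq_nonneg (y - τ)]) (norm_nonneg _) |>.2
    have h2 : τ - y ≤ ‖x - (R + τ) • e‖ :=
      abs_le_of_sq_le_sq' (by nlinarith [sq_nonneg p]) (norm_nonneg _) |>.2
    linarith [le_abs_self y]
  have hnum : |‖x‖ ^ 2 - ‖(R + τ) • e‖ ^ 2| ≤ 2 * R * |y| + 2 * p ^ 2 + 3 * R * τ := by
    rw [hα, hx2]
    have hy2 : y ^ 2 ≤ p ^ 2 := by rw [← sq_abs y]; exact pow_le_pow_left₀ (abs_nonneg y) hyp 2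
    have h1 := mul_le_mul_of_nonneg_left (le_abs_self y) hR.le
    have h2 := mul_le_mul_of_nonneg_left (neg_abs_le y) hR.le
    rw [abs_le]
    constructor <;> nlinarith [sq_nonneg y, sq_nonneg p, mul_pos hR hτ]
  rw [hFun, abs_mul, abs_div, abs_of_nonneg (by positivity : 0 ≤ ‖(R + τ) • e‖ ^ (n - 2)),
    abs_of_nonneg (by positivity : 0 ≤ ‖x - (R + τ) • e‖ ^ n), mul_assoc]
  -- The power `p ^ (n - 2)` is split off to cancel the polar Jacobian; `(p + τ) ^ 2` is kept
  -- because the `τ` term would not be uniformly integrable with `p ^ 2`.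
  have hpow : p ^ (n - 2) * (p + τ) ^ 2 ≤ (p + τ) ^ n := by
    calc _ ≤ (p + τ) ^ (n - 2) * (p + τ) ^ 2 := by gcongr; linarith
      _ = _ := by rw [← pow_add]; congr 1; omega
  have hmain : |‖x‖ ^ 2 - ‖(R + τ) • e‖ ^ 2| / ‖x - (R + τ) • e‖ ^ n ≤
      3 ^ n * ((p ^ (n - 2))⁻¹ * (2 * R * |y| / p ^ 2 + 2 + 3 * R * (τ / (p + τ) ^ 2))) := by
    calc _ ≤ (2 * R * |y| + 2 * p ^ 2 + 3 * R * τ) / ((p + τ) / 3) ^ n := by gcongr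
      _ = 3 ^ n * ((2 * R * |y| + 2 * p ^ 2 + 3 * R * τ) / (p + τ) ^ n) := by
        rw [div_pow]; field_simp
      _ ≤ 3 ^ n * ((2 * R * |y| + 2 * p ^ 2 + 3 * R * τ) / (p ^ (n - 2) * (p + τ) ^ 2)) := by
        gcongr
      _ = 3 ^ n * ((p ^ (n - 2))⁻¹ * ((2 * R * |y| + 2 * p ^ 2) / (p + τ) ^ 2
            + 3 * R * (τ / (p + τ) ^ 2))) := by
        field_simp
      _ ≤ 3 ^ n * ((p ^ (n - 2))⁻¹ * ((2 * R * |y| + 2 * p ^ 2) / p ^ 2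
            + 3 * R * (τ / (p + τ) ^ 2))) := by
        gcongr; linarith
      _ = _ := by
        rw [add_div, mul_div_cancel_right₀ _ (by positivity : p ^ 2 ≠ 0)]
  refine mul_le_mul (pow_le_pow_left₀ (norm_nonneg _) (by rw [hα]; linarith) _) hmain
    (by positivity) (by positivity)

variable {D : Set (EuclideanSpace ℝ (Fin n))} {z : EuclideanSpace ℝ (Fin n)}

/-- The integrals of the kernels near a regular touching point are uniformly bounded. -/
theorem exists_lintegral_near_le (hn : 2 ≤ n) (hD : IsOpen D) (h0 : 0 ∈ D)
    (hz : z ∈ touchingSet D 0) :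
    ∃ δ > 0, ∃ C < (⊤ : ℝ≥0∞), ∀ t : ℝ, 1 < t → t ≤ 2 →
      ∫⁻ x in frontier D ∩ Metric.ball z δ, ENNReal.ofReal |hFun (t • z) x| ∂μHE[n - 1] ≤ C := by
  obtain ⟨-, ω, hω, δ, hδ, hlip, hheight⟩ := exists_local_graph hD h0 hz
  have hzpos := (norm_eq_infDist_of_mem_touchingSet hD h0 hz).1
  set R := ‖z‖ with hR_def
  set e := R⁻¹ • z with he_def
  have he : ‖e‖ = 1 := by
    rw [he_def, norm_smul, norm_inv, hR_def, norm_norm, inv_mul_cancel₀ hzpos.ne']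
  have hze : z = R • e := by rw [he_def, smul_smul, mul_inv_cancel₀ hzpos.ne', one_smul]
  obtain ⟨C, hC⟩ := exists_lintegral_le_of_graph (E := EuclideanSpace ℝ (Fin n)) (d := n - 1)
    (by simp; omega) (by omega) he
  set A : ℝ := (2 * R) ^ (n - 2) * 3 ^ n with hA
  set W : ℝ := ∫ r in Set.Ioo 0 δ, ω (2 * r) / r with hW
  refine ⟨δ, hδ, C * ENNReal.ofReal (A * (8 * R * W + 2 * δ + 3 * R)),
    ENNReal.mul_lt_top ENNReal.coe_lt_top ENNReal.ofReal_lt_top, fun t ht1 ht2 => ?_⟩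
  set τ := (t - 1) * R with hτ_def
  have hτ : 0 < τ := mul_pos (by linarith) hzpos
  have hτR : τ ≤ R := by nlinarith
  have htz : t • z = (R + τ) • e := by rw [hze, smul_smul, hτ_def]; congr 1; ring
  set φ : ℝ → ℝ := fun r => 8 * R * (ω (2 * r) / r) + 2 + 3 * R * (τ / (r + τ) ^ 2) with hφ
  set f : ℝ → ℝ := (Set.Ioo 0 δ).indicator fun r => A * ((r ^ (n - 2))⁻¹ * φ r) with hf
  have hφ0 : ∀ r, 0 < r → 0 ≤ φ r := fun r hr => by
    have := hω.pos (2 * r) (by positivity)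
    positivity
  have hf0 : ∀ r, 0 ≤ f r := fun r => by
    refine Set.indicator_nonneg (fun r hr => ?_) r
    have := hφ0 r hr.1
    have := hr.1
    positivity
  have hω_int := hω.integrableOn_comp_two_mul hδ
  obtain ⟨hτ_int, hτ_le⟩ := integral_div_add_sq_le hδ hτ
  have hφ_int : IntegrableOn φ (Set.Ioo 0 δ) :=
    ((hω_int.const_mul _).add (integrableOn_const (by simp))).add (hτ_int.const_mul _)
  -- The hyperplane has dimension `n - 1`, so its Jacobian exponent is exactly `n - 2`.
  have hrf : (fun r => r ^ (n - 1 - 1) * f r) = (Set.Ioo 0 δ).indicator fun r => A * φ r := by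
    ext r
    by_cases hr : r ∈ Set.Ioo 0 δ
    · have : r ^ (n - 2) ≠ 0 := (pow_pos hr.1 _).ne'
      rw [hf, Set.indicator_of_mem hr, Set.indicator_of_mem hr, Nat.sub_sub]
      field_simp
    · rw [hf, Set.indicator_of_notMem hr, Set.indicator_of_notMem hr, mul_zero]
  have hfi : IntegrableOn (fun r => r ^ (n - 1 - 1) * f r) (Set.Ioi 0) := by
    rw [hrf]
    exact ((integrable_indicator_iff measurableSet_Ioo).2 (hφ_int.const_mul A)).integrableOn
  have hval : ∫ r in Set.Ioi (0 : ℝ), r ^ (n - 1 - 1) * f r ≤ A * (8 * R * W + 2 * δ + 3 * R) := by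
    rw [hrf, setIntegral_indicator measurableSet_Ioo,
      Set.inter_eq_right.2 Set.Ioo_subset_Ioi_self, integral_const_mul]
    refine mul_le_mul_of_nonneg_left ?_ (by positivity)
    have hW_int : IntegrableOn (fun r => 8 * R * (ω (2 * r) / r)) (Set.Ioo 0 δ) :=
      hω_int.const_mul _
    have hc_int : IntegrableOn (fun _ : ℝ => (2 : ℝ)) (Set.Ioo 0 δ) := integrableOn_const (by simp)
    have hsum : ∫ r in Set.Ioo 0 δ, φ r =
        8 * R * W + 2 * δ + 3 * R * ∫ r in Set.Ioo 0 δ, τ / (r + τ) ^ 2 := by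
      have hWc_int : IntegrableOn (fun r => 8 * R * (ω (2 * r) / r) + 2) (Set.Ioo 0 δ) :=
        hW_int.add hc_int
      rw [hφ, integral_add hWc_int (hτ_int.const_mul _), integral_add hW_int hc_int,
        integral_const_mul, integral_const_mul]
      simp only [integral_const, measureReal_restrict_apply_univ, Real.volume_real_Ioo_of_le hδ.le,
        smul_eq_mul, sub_zero]
      ring
    rw [hsum]
    nlinarith
  refine (hC z (frontier D ∩ Metric.ball z δ) ⟨hz.1.1, Metric.mem_ball_self hδ⟩
    (isClosed_frontier.measurableSet.inter measurableSet_ball) hlip f hf0 hfi _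
    fun x hx hxz => ENNReal.ofReal_le_ofReal ?_).trans
    (mul_le_mul_right (ENNReal.ofReal_le_ofReal hval) _)
  have hyp := hlip x hx z ⟨hz.1.1, Metric.mem_ball_self hδ⟩
  -- On the graph, a vanishing tangential part forces the height to vanish too, hence `x = z`.
  have hp0 : 0 < ‖tangentialPart e (x - z)‖ := by
    refine (norm_nonneg _).lt_of_ne fun h => ?_
    have := norm_le_inner_add_tangentialPart he (x - z)
    have h2 : ‖x - z‖ ≤ 0 := by linarith
    exact hxz (sub_eq_zero.1 (norm_le_zero_iff.1 h2))
  have hpδ : ‖tangentialPart e (x - z)‖ < δ :=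
    (norm_tangentialPart_le he _).trans_lt (mem_ball_iff_norm.1 hx.2)
  have hh := hheight x hx
  have hmain := abs_hFun_le_of_near hn (x := x) (R := R) he hτ hτR hp0 (by rw [← hze])
    (by rw [← hze]) hyp
  set p := ‖tangentialPart e (x - z)‖
  rw [hf, Set.indicator_of_mem (show p ∈ Set.Ioo 0 δ from ⟨hp0, hpδ⟩), htz]
  refine hmain.trans ?_
  have : 2 * R * |inner ℝ e (x - z)| / p ^ 2 ≤ 8 * R * (ω (2 * p) / p) := by
    calc _ ≤ 2 * R * (4 * ω (2 * p) * p) / p ^ 2 := by gcongr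
      _ = _ := by field_simp; ring
  simp only [hφ]
  gcongr

/-- The integrals of the kernels over the boundary stay bounded as the pole tends radially to a
regular touching point. -/
theorem exists_lintegral_hFun_le (hn : 2 ≤ n) (hD : IsOpen D) (hDb : Bornology.IsBounded D)
    (hDa : μHE[n - 1] (frontier D) < ⊤) (h0 : 0 ∈ D) (hz : z ∈ touchingSet D 0) :
    ∃ C < (⊤ : ℝ≥0∞), ∀ᶠ t in 𝓝[>] (1 : ℝ),
      ∫⁻ x in frontier D, ENNReal.ofReal |hFun (t • z) x| ∂μHE[n - 1] ≤ C := by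
  obtain ⟨δ, hδ, C, hC, hnear⟩ := exists_lintegral_near_le hn hD h0 hz
  have hzpos := (norm_eq_infDist_of_mem_touchingSet hD h0 hz).1
  obtain ⟨B, hB⟩ := hDb.closure.exists_norm_le
  set K : ℝ := (2 * ‖z‖) ^ (n - 2) * ((B ^ 2 + (2 * ‖z‖) ^ 2) / (δ / 2) ^ n)
  refine ⟨C + ENNReal.ofReal K * μHE[n - 1] (frontier D),
    ENNReal.add_lt_top.2 ⟨hC, ENNReal.mul_lt_top ENNReal.ofReal_lt_top hDa⟩, ?_⟩
  -- This yields `t ≤ 2` and `|t z - z| ≤ δ/2`, so points outside the `δ`-ball stay at distance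
  -- `δ/2` from the pole.
  have hev : ∀ᶠ t in 𝓝[>] (1 : ℝ), t < 1 + min 1 (δ / (2 * ‖z‖)) :=
    nhdsWithin_le_nhds (Iio_mem_nhds (by
      have : 0 < min 1 (δ / (2 * ‖z‖)) := by positivity
      linarith))
  filter_upwards [hev, self_mem_nhdsWithin] with t ht (ht1 : 1 < t)
  have ht2 : t ≤ 2 := by linarith [min_le_left 1 (δ / (2 * ‖z‖))]
  have htδ : (t - 1) * ‖z‖ ≤ δ / 2 := by
    have : t - 1 ≤ δ / (2 * ‖z‖) := by linarith [min_le_right 1 (δ / (2 * ‖z‖))]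
    calc _ ≤ δ / (2 * ‖z‖) * ‖z‖ := by gcongr
      _ = δ / 2 := by field_simp
  rw [← lintegral_inter_add_sdiff _ (frontier D) (measurableSet_ball (x := z) (ε := δ))]
  refine add_le_add (hnear t ht1 ht2) ?_
  calc ∫⁻ x in frontier D \ Metric.ball z δ, ENNReal.ofReal |hFun (t • z) x| ∂μHE[n - 1]
      ≤ ∫⁻ _ in frontier D \ Metric.ball z δ, ENNReal.ofReal K ∂μHE[n - 1] := by
        refine setLIntegral_mono measurable_const fun x hx => ENNReal.ofReal_le_ofReal ?_
        have hxz : δ ≤ ‖x - z‖ := by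
          have := hx.2
          rwa [mem_ball_iff_norm, not_lt] at this
        refine abs_hFun_le_of_far ?_ (hB x (frontier_subset_closure hx.1)) (by positivity) ?_
        · rw [norm_smul, Real.norm_eq_abs, abs_of_pos (by linarith)]
          gcongr
        · have h1 : ‖t • z - z‖ = (t - 1) * ‖z‖ := by
            rw [show t • z - z = (t - 1) • z by module, norm_smul, Real.norm_eq_abs, abs_of_pos (by linarith)]
          have h2 := norm_sub_le_norm_sub_add_norm_sub x (t • z) z
          linarith
    _ ≤ ENNReal.ofReal K * μHE[n - 1] (frontier D) := by
        rw [setLIntegral_const]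
        gcongr
        exact Set.sdiff_subset

end KernelBounds

/-! ### Finiteness of `L` and `L*` at a touching point. -/

section Gap

variable {n : ℕ} {D : Set (EuclideanSpace ℝ (Fin n))} {z : EuclideanSpace ℝ (Fin n)}

theorem radialFilter_le : radialFilter D z ≤ 𝓝[>] 1 := nhdsWithin_mono _ fun _ ht => ht.1

/-- The outward normal at `z` is `z/|z|`, so radial points just beyond `z` lie outside `closure D`.
Without this the `liminf` defining `L` would be `⊤`. -/
theorem radialFilter_neBot (hD : IsOpen D) (h0 : 0 ∈ D) (hz : z ∈ touchingSet D 0) :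
    (radialFilter D z).NeBot := by
  have hzpos := (norm_eq_infDist_of_mem_touchingSet hD h0 hz).1
  have hout := (exists_local_graph hD h0 hz).1
  have htend : Tendsto (fun t : ℝ => (t - 1) * ‖z‖) (𝓝[>] 1) (𝓝[>] 0) := by
    refine tendsto_nhdsWithin_iff.2 ⟨?_, ?_⟩
    · have : Continuous fun t : ℝ => (t - 1) * ‖z‖ := by fun_prop
      simpa using (this.tendsto 1).mono_left nhdsWithin_le_nhds
    · filter_upwards [self_mem_nhdsWithin] with t (ht : 1 < t)
      exact mul_pos (sub_pos.2 ht) hzpos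
  have hle : 𝓝[>] (1 : ℝ) ≤ radialFilter D z := by
    rw [radialFilter, nhdsWithin_le_iff]
    filter_upwards [htend.eventually hout, self_mem_nhdsWithin] with t ht ht1
    refine ⟨ht1, ?_⟩
    convert ht using 2
    rw [smul_smul, mul_assoc, mul_inv_cancel₀ hzpos.ne', mul_one]
    module
  exact NeBot.mono inferInstance hle

theorem kFun_zero (hz : z ≠ 0) (hn : 2 ≤ n) : kFun z 0 = 0 := by
  have hz' : ‖z‖ ≠ 0 := norm_ne_zero_iff.2 hz
  have : ‖z‖ ^ n = ‖z‖ ^ (n - 2) * ‖z‖ ^ 2 := by rw [← pow_add]; congr 1; omega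
  rw [kFun, hFun, norm_zero, zero_sub, norm_neg, this]
  field_simp
  ring

/-- The mean of the Kuran function is controlled by the mean of the absolute value of its kernel. -/
theorem ofReal_abs_average_kFun_le (α : EuclideanSpace ℝ (Fin n)) :
    ENNReal.ofReal |⨍ x in frontier D, kFun α x ∂μHE[n - 1]| ≤
      1 + ⨍⁻ x in frontier D, ENNReal.ofReal |hFun α x| ∂μHE[n - 1] := by
  rw [average_eq', laverage_eq']
  set μ := (μHE[n - 1].restrict (frontier D) Set.univ)⁻¹ •
    (μHE[n - 1].restrict (frontier D) : Measure (EuclideanSpace ℝ (Fin n))) with hμ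
  -- An inequality suffices and also covers a boundary of zero or infinite measure.
  have hμ1 : μ Set.univ ≤ 1 := by
    rw [hμ, Measure.smul_apply, smul_eq_mul]
    exact ENNReal.inv_mul_le_one _
  calc ENNReal.ofReal |∫ x, kFun α x ∂μ|
      = ‖∫ x, kFun α x ∂μ‖ₑ := (Real.enorm_eq_ofReal_abs _).symm
    _ ≤ ∫⁻ x, ‖kFun α x‖ₑ ∂μ := enorm_integral_le_lintegral_enorm _
    _ ≤ ∫⁻ x, (1 + ENNReal.ofReal |hFun α x|) ∂μ := by
        refine lintegral_mono fun x => ?_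
        rw [Real.enorm_eq_ofReal_abs, ← ENNReal.ofReal_one,
          ← ENNReal.ofReal_add zero_le_one (abs_nonneg _)]
        refine ENNReal.ofReal_le_ofReal ((abs_add_le _ _).trans_eq (by rw [abs_one]))
    _ = μ Set.univ + ∫⁻ x, ENNReal.ofReal |hFun α x| ∂μ := by
        rw [lintegral_add_left measurable_const, lintegral_one]
    _ ≤ _ := by gcongr

theorem exists_laverage_hFun_le (hn : 2 ≤ n) (hD : IsOpen D) (hDb : Bornology.IsBounded D)
    (hDa : μHE[n - 1] (frontier D) < ⊤) (h0 : 0 ∈ D) (hz : z ∈ touchingSet D 0) :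
    ∃ C < (⊤ : ℝ≥0∞), ∀ᶠ t in radialFilter D z,
      ⨍⁻ x in frontier D, ENNReal.ofReal |hFun (t • z) x| ∂μHE[n - 1] ≤ C := by
  obtain ⟨C, hC, h⟩ := exists_lintegral_hFun_le hn hD hDb hDa h0 hz
  -- For zero area the quotient bound could be `⊤`, but the average is then `0`.
  rcases eq_or_ne (μHE[n - 1] (frontier D)) 0 with hμ | hμ
  · refine ⟨0, ENNReal.zero_lt_top, Eventually.of_forall fun t => ?_⟩
    simp [Measure.restrict_eq_zero.2 hμ]
  · refine ⟨C / μHE[n - 1] (frontier D), ENNReal.div_lt_top hC.ne hμ, ?_⟩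
    filter_upwards [radialFilter_le h] with t ht
    rw [setLAverage_eq]
    exact ENNReal.div_le_div_right ht _

theorem gapLStar_lt_top (hn : 2 ≤ n) (hD : IsOpen D) (hDb : Bornology.IsBounded D)
    (hDa : μHE[n - 1] (frontier D) < ⊤) (h0 : 0 ∈ D) (hz : z ∈ touchingSet D 0) :
    gapLStar D z < ⊤ := by
  obtain ⟨C, hC, h⟩ := exists_laverage_hFun_le hn hD hDb hDa h0 hz
  exact (limsup_le_of_le (by isBoundedDefault) h).trans_lt hC

theorem gapL_lt_top (hn : 2 ≤ n) (hD : IsOpen D) (hDb : Bornology.IsBounded D)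
    (hDa : μHE[n - 1] (frontier D) < ⊤) (h0 : 0 ∈ D) (hz : z ∈ touchingSet D 0) :
    gapL D z < ⊤ := by
  obtain ⟨C, hC, h⟩ := exists_laverage_hFun_le hn hD hDb hDa h0 hz
  have := radialFilter_neBot hD h0 hz
  have hz0 : z ≠ 0 := norm_pos_iff.1 (norm_eq_infDist_of_mem_touchingSet hD h0 hz).1
  -- Passing from `liminf` to `limsup` is where nontriviality of the radial filter enters.
  refine lt_of_le_of_lt ((liminf_le_limsup (by isBoundedDefault) (by isBoundedDefault)).trans (limsup_le_of_le (by isBoundedDefault) ?_))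
    (ENNReal.add_lt_top.2 ⟨ENNReal.one_lt_top, hC⟩)
  have hgt : ∀ᶠ t in radialFilter D z, 1 < t := radialFilter_le self_mem_nhdsWithin
  filter_upwards [h, hgt] with t ht ht1
  rw [kFun_zero (smul_ne_zero (by linarith) hz0) hn, zero_sub, abs_neg]
  exact (ofReal_abs_average_kFun_le _).trans (by gcongr)

end Gap

/-! ### Translation invariance of the touching set. -/

section Translation

variable {n : ℕ} {D : Set (EuclideanSpace ℝ (Fin n))} (a : EuclideanSpace ℝ (Fin n))

theorem translate_eq_preimage (D : Set (EuclideanSpace ℝ (Fin n)))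
    (x₀ : EuclideanSpace ℝ (Fin n)) : translate D x₀ = (fun x => x₀ + x) ⁻¹' D := by
  rw [translate, Set.image_add_left, neg_neg]

theorem frontier_preimage_add_left (S : Set (EuclideanSpace ℝ (Fin n))) :
    frontier ((fun x => a + x) ⁻¹' S) = (fun x => a + x) ⁻¹' frontier S :=
  ((Homeomorph.addLeft a).preimage_frontier S).symm

theorem closure_preimage_add_left (S : Set (EuclideanSpace ℝ (Fin n))) :
    closure ((fun x => a + x) ⁻¹' S) = (fun x => a + x) ⁻¹' closure S :=
  ((Homeomorph.addLeft a).preimage_closure S).symm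

theorem biggestBall_preimage_add_left (x₀ : EuclideanSpace ℝ (Fin n)) :
    biggestBall ((fun x => a + x) ⁻¹' D) x₀ = (fun x => a + x) ⁻¹' biggestBall D (a + x₀) := by
  have h := Metric.infDist_image (IsometryEquiv.addLeft a).isometry (x := x₀)
    (t := (fun x => a + x) ⁻¹' frontier D)
  have himg : (IsometryEquiv.addLeft a) '' ((fun x => a + x) ⁻¹' frontier D) = frontier D :=
    Set.image_preimage_eq _ (IsometryEquiv.addLeft a).surjective
  rw [himg] at h
  rw [biggestBall, biggestBall, frontier_preimage_add_left, ← h]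
  exact ((IsometryEquiv.addLeft a).isometry.preimage_ball x₀ _).symm

theorem IsC1Hypersurface.preimage_add_left {S : Set (EuclideanSpace ℝ (Fin n))}
    (h : IsC1Hypersurface S) : IsC1Hypersurface ((fun x => a + x) ⁻¹' S) := by
  intro x hx
  obtain ⟨U, g, hU, hxU, hg, hg', hSU⟩ := h _ hx
  refine ⟨(fun x => a + x) ⁻¹' U, fun y => g (a + y), hU.preimage (continuous_const_add a), hxU,
    hg.comp (by fun_prop) fun y hy => hy, fun y hy => ?_, ?_⟩
  · rw [fderiv_comp_add_left]
    exact hg' _ hy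
  · ext y
    exact Set.ext_iff.1 hSU (a + y)

theorem IsOutwardUnitNormal.preimage_add_left {x v : EuclideanSpace ℝ (Fin n)}
    (h : IsOutwardUnitNormal D (a + x) v) :
    IsOutwardUnitNormal ((fun x => a + x) ⁻¹' D) x v := by
  refine ⟨h.1, fun w hw => h.2.1 w ?_, h.2.2.mono fun t ht => ?_⟩
  · rw [frontier_preimage_add_left, tangentConeAt_def] at hw
    rw [tangentConeAt_def]
    convert hw using 6
    ext y
    simp [add_assoc]
  · rw [closure_preimage_add_left]
    simpa only [Set.mem_preimage, add_assoc, add_sub_assoc] using ht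

theorem IsLyapunovDiniAt.preimage_add_left {z : EuclideanSpace ℝ (Fin n)}
    (h : IsLyapunovDiniAt D (a + z)) : IsLyapunovDiniAt ((fun x => a + x) ⁻¹' D) z := by
  obtain ⟨hz, V, hV, hzV, hS, ν, hν, ω, hω, δ, hδ, hd⟩ := h
  rw [IsLyapunovDiniAt, frontier_preimage_add_left]
  refine ⟨hz, (fun x => a + x) ⁻¹' V, hV.preimage (continuous_const_add a), hzV,
    hS.preimage_add_left a, fun x => ν (a + x), fun x hx => (hν _ hx).preimage_add_left a,
    ω, hω, δ, hδ, fun x hx h1 h2 => ?_⟩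
  have := hd (a + x) hx
  rw [add_sub_add_left_eq_sub] at this
  exact this h1 h2

theorem mem_touchingSet_preimage_add_left {x₀ z : EuclideanSpace ℝ (Fin n)}
    (h : a + z ∈ touchingSet D (a + x₀)) : z ∈ touchingSet ((fun x => a + x) ⁻¹' D) x₀ := by
  refine ⟨⟨?_, ?_⟩, h.2.preimage_add_left a⟩
  · rw [frontier_preimage_add_left]; exact h.1.1
  · rw [biggestBall_preimage_add_left, frontier_preimage_add_left]; exact h.1.2

theorem touchingSet_translate_nonempty_iff (x₀ : EuclideanSpace ℝ (Fin n)) :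
    (touchingSet (translate D x₀) 0).Nonempty ↔ (touchingSet D x₀).Nonempty := by
  constructor
  · rintro ⟨z, hz⟩
    refine ⟨x₀ + z, ?_⟩
    have hD : (fun x => -x₀ + x) ⁻¹' translate D x₀ = D := by
      rw [translate_eq_preimage]
      ext x
      simp
    rw [← hD]
    exact mem_touchingSet_preimage_add_left _ (by simpa using hz)
  · rintro ⟨z, hz⟩
    refine ⟨-x₀ + z, ?_⟩
    rw [translate_eq_preimage]
    exact mem_touchingSet_preimage_add_left _ (by simpa using hz)

end Translation

end KuranGap

/-! ### Reduction to centre `0` and conclusion. -/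

theorem proposition3p1 (n : ℕ) (hn : 2 ≤ n) (D : Set (EuclideanSpace ℝ (Fin n)))
    (hD_open : IsOpen D) (hD_bdd : Bornology.IsBounded D)
    (x₀ : EuclideanSpace ℝ (Fin n)) (hx₀ : x₀ ∈ D)
    (hD_area : μHE[n - 1] (frontier D) < ⊤) :
    ((KuranGap.touchingSet D x₀).Nonempty → KuranGap.hStar D x₀ < ⊤) ∧
      (KuranGap.kuranGap D x₀ < ⊤ ↔ (KuranGap.touchingSet D x₀).Nonempty) := by
  have hpre := KuranGap.translate_eq_preimage D x₀
  have hopen : IsOpen (KuranGap.translate D x₀) := by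
    rw [hpre]; exact hD_open.preimage (continuous_const_add x₀)
  have hbdd : Bornology.IsBounded (KuranGap.translate D x₀) :=
    (LipschitzWith.of_edist_le (f := fun x => -x₀ + x) fun x y => by
      rw [edist_add_left]).isBounded_image hD_bdd
  have h0 : (0 : EuclideanSpace ℝ (Fin n)) ∈ KuranGap.translate D x₀ := by
    rw [hpre]; simpa using hx₀
  have harea : μHE[n - 1] (frontier (KuranGap.translate D x₀)) < ⊤ := by
    rw [hpre, KuranGap.frontier_preimage_add_left, measure_preimage_add]
    exact hD_area
  rw [← KuranGap.touchingSet_translate_nonempty_iff]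
  refine ⟨?_, ?_, ?_⟩
  · rintro ⟨z, hz⟩
    exact (iInf₂_le z hz).trans_lt (KuranGap.gapLStar_lt_top hn hopen hbdd harea h0 hz)
  · intro h
    by_contra hne
    rw [Set.not_nonempty_iff_eq_empty] at hne
    simp [KuranGap.kuranGap, hne] at h
  · rintro ⟨z, hz⟩
    exact (iInf₂_le z hz).trans_lt (KuranGap.gapL_lt_top hn hopen hbdd harea h0 hz)
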